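/- Conventions. A smooth submanifold $M\subseteq\mathbb R^D$ is embedded and without boundary, with the metric induced by $\mathbb R^D$; $T_xM$ is the space of velocities $\gamma'(0)$ of smooth curves $\gamma:\mathbb R\to M$ with $\gamma(0)=x$. For differentiable $f:M\to\mathbb R$, $\nabla f(x)\in T_xM$ is the vector with $\frac{d}{dt}f(\gamma(t))|_{t=0}=\langle\nabla f(x),\gamma'(0)\rangle$ for all such $\gamma$. For differentiable $X:M\to\mathbb R^n$ the Jacobian $\partial X(x)\in\mathbb R^{n\times D}$ has rows $\nabla X_1(x)^\top,\dots,\nabla X_n(x)^\top$, so $\ker\partial X(x)=\operatorname{span}\{\nabla X_i(x)\}_i^{\perp}$ in $\mathbb R^D$. The Lie bracket of $C^1$ vector fields on $M$ is $[X,Y](x)=\partial Y(x)X(x)-\partial X(x)Y(x)$. A $C^1$ map $G:M\to\mathbb R^d$ is a *regular parametrization* if $\partial G(x)$ has rank $d$ for all $x\in M$. A *Legendre function* is a convex function $R:\mathbb R^d\to\mathbb R\cup\{\infty\}$ whose domain $\operatorname{dom}R=\{R<\infty\}$ has non-empty interior, which is differentiable and strictly convex on $\operatorname{int}(\operatorname{dom}R)$,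 and which satisfies $\|\nabla R(w_i)\|_2\to\infty$ for every sequence $(w_i)$ in $\operatorname{int}(\operatorname{dom}R)$ converging to a boundary point of $\operatorname{dom}R$. A *time-dependent loss* is a family $L_t:\mathbb R^d\to\mathbb R$, $t\ge0$, for which there are $k\ge1$, $0=t_1<t_2<\dots<t_{k+1}=\infty$ and $C^1$ functions $L^{(1)},\dots,L^{(k)}:\mathbb R^d\to\mathbb R$ with $L_t=L^{(i)}$ for all $t\in[t_i,t_{i+1})$. A solution on $[0,T)$ of the *gradient flow* of $L_t\circ G$ initialized at $x_{\mathrm{init}}\in M$ is a continuous $x:[0,T)\to M$ with $x(0)=x_{\mathrm{init}}$ and $dx(t)=-\nabla(L_t\circ G)(x(t))\,dt$ (in integral form; equivalently, in terms of right derivatives). We say that this gradient flow *can be written as the mirror flow under $L_t$ with respect to $R$* if for each such solution, on whatever interval $[0,T)$ it exists, $w(t)=G(x(t))$ lies in $\operatorname{int}(\operatorname{dom}R)$ and $d\nabla R(w(t))=-\nabla L_t(w(t))\,dt$ on $[0,T)$. **Theorem.** Let $M$ be a smooth submanifold of $\mathbb R^D$ and $G:M\to\mathbb R^d$ a smooth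 parametrization. Suppose that for every $x_{\mathrm{init}}\in M$ there is a Legendre function $R$ such that for all time-dependent losses $L_t$ the gradient flow of $L_t\circ G$ initialized at $x_{\mathrm{init}}$ can be written as the mirror flow under $L_t$ with respect to $R$. Then $G$ is a regular parametrization, and for each $x\in M$ $$\mathrm{Lie}^{\ge2}(\partial G)\big|_x\subseteq\ker(\partial G(x)),$$ where $\mathrm{Lie}^{\ge K}(\partial G)=\operatorname{span}\big\{[[[[\nabla G_{j_1},\nabla G_{j_2}],\dots],\nabla G_{j_{k-1}}],\nabla G_{j_k}] : k\ge K,\ j_1,\dots,j_k\in\{1,\dots,d\}\big\}$ and $\mathrm{Lie}^{\ge K}(\partial G)|_x$ is the set of the values at $x$ of its elements. -/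

import Mathlib

open Set Filter Topology
open scoped ContDiff

noncomputable section

namespace MirrorFlow

/-- The Euclidean space `ℝⁿ`. -/
abbrev E (n : ℕ) := EuclideanSpace ℝ (Fin n)

/-! ### Submanifolds of Euclidean space, tangent spaces, gradients, Lie brackets -/

/-- `M` is an (embedded, boundaryless) smooth submanifold of `ℝ^D` of dimension `m`: near each of
its points it is carried to the slice `ℝ^m × {0}` by a diffeomorphism between open subsets of
`ℝ^D`. -/
def IsSmoothSubmanifold {D : ℕ} (m : ℕ) (M : Set (E D)) : Prop :=
  m ≤ D ∧ ∀ x ∈ M, ∃ Φ : OpenPartialHomeomorph (E D) (E D), x ∈ Φ.source ∧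
    ContDiffOn ℝ ∞ Φ Φ.source ∧ ContDiffOn ℝ ∞ Φ.symm Φ.target ∧
    ∀ y ∈ Φ.source, (y ∈ M ↔ ∀ i : Fin D, m ≤ (i : ℕ) → Φ y i = 0)

/-- `γ : ℝ → M` is a smooth curve with `γ 0 = x`. -/
def IsSmoothCurveAt {D : ℕ} (M : Set (E D)) (x : E D) (γ : ℝ → E D) : Prop :=
  ContDiff ℝ ∞ γ ∧ (∀ t, γ t ∈ M) ∧ γ 0 = x

/-- The tangent space `T_x M`, consisting of the velocities `γ'(0)` of smooth curves `γ : ℝ → M`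
with `γ 0 = x`. (At a point of a submanifold these velocities already form a linear subspace, so
that taking the span adds nothing.) -/
def tangentSpace {D : ℕ} (M : Set (E D)) (x : E D) : Submodule ℝ (E D) :=
  Submodule.span ℝ {v | ∃ γ : ℝ → E D, IsSmoothCurveAt M x γ ∧ deriv γ 0 = v}

/-- The gradient of `f : M → ℝ` at `x` for the metric induced by `ℝ^D`: the vector of `T_x M` that
represents the derivative of `f` along `M`. `gradientWithin f M x` represents one derivative of `f`
relative to `M`; only its tangential component is determined by `f`, and it is kept. -/
def grad {D : ℕ} (M : Set (E D)) (f : E D → ℝ) (x : E D) : E D :=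
  (tangentSpace M x).starProjection (gradientWithin f M x)

/-- `grad M f x` lies in the tangent space. -/
theorem grad_mem {D : ℕ} (M : Set (E D)) (f : E D → ℝ) (x : E D) :
    grad M f x ∈ tangentSpace M x :=
  Submodule.starProjection_apply_mem _ _

/-- `grad M f x` represents the derivative of `f` along smooth curves in `M` through `x`; with
`grad_mem` this determines it. -/
theorem hasDerivAt_comp_curve {D : ℕ} {M : Set (E D)} {f : E D → ℝ} {x : E D}
    (hf : DifferentiableWithinAt ℝ f M x) {γ : ℝ → E D} (hγ : IsSmoothCurveAt M x γ) :
    HasDerivAt (fun t => f (γ t)) (inner ℝ (grad M f x) (deriv γ 0)) 0 := by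
  obtain ⟨hs, hM, h0⟩ := hγ
  have hd : HasDerivAt γ (deriv γ 0) 0 :=
    (hs.differentiable (by simp)).differentiableAt.hasDerivAt
  have hmem : deriv γ 0 ∈ tangentSpace M x := Submodule.subset_span ⟨γ, ⟨hs, hM, h0⟩, rfl⟩
  have h1 : HasFDerivWithinAt f (fderivWithin ℝ f M x) M (γ 0) := by
    rw [h0]; exact hf.hasFDerivWithinAt
  have h2 := h1.comp_hasDerivWithinAt (0 : ℝ) hd.hasDerivWithinAt
    (fun t (_ : t ∈ univ) => hM t)
  rw [hasDerivWithinAt_univ] at h2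
  have h3 : inner ℝ (grad M f x) (deriv γ 0) = fderivWithin ℝ f M x (deriv γ 0) := by
    rw [grad, Submodule.inner_starProjection_left_eq_right,
      Submodule.starProjection_eq_self_iff.2 hmem, gradientWithin,
      InnerProductSpace.toDual_symm_apply]
  rw [h3]
  exact h2

/-- The Jacobian `∂X(x) = (∇X₁(x), …, ∇Xₙ(x))ᵀ` of `X : M → ℝⁿ`, as the linear map
`v ↦ (⟪∇X₁(x), v⟫, …, ⟪∇Xₙ(x), v⟫)` from `ℝ^D` to `ℝⁿ`. -/
def jacobian {D n : ℕ} (M : Set (E D)) (X : E D → E n) (x : E D) : E D →ₗ[ℝ] E n :=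
  (WithLp.linearEquiv 2 ℝ (Fin n → ℝ)).symm.toLinearMap ∘ₗ
    LinearMap.pi fun i => (innerSL ℝ (grad M (fun y => X y i) x)).toLinearMap

/-- The Lie bracket `[X, Y](x) = ∂Y(x) X(x) - ∂X(x) Y(x)` of vector fields on `M`. -/
def lieBracket {D : ℕ} (M : Set (E D)) (X Y : E D → E D) (x : E D) : E D :=
  jacobian M Y x (X x) - jacobian M X x (Y x)

/-! ### Parametrizations -/

/-- A regular parametrization `G : M → ℝ^d`: it is `C¹` and its Jacobian has rank `d` on `M`. -/
def IsRegularParametrization {D d : ℕ} (M : Set (E D)) (G : E D → E d) : Prop :=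
  ContDiffOn ℝ 1 G M ∧
    ∀ x ∈ M, Module.finrank ℝ (LinearMap.range (jacobian M G x)) = d

/-- The gradient vector field `∇G_j` on `M` of the `j`-th coordinate of `G`. -/
def gradCoord {D d : ℕ} (M : Set (E D)) (G : E D → E d) (j : Fin d) : E D → E D :=
  grad M (fun y => G y j)

/-- `[[[∇G_{j₁}, ∇G_{j₂}], …], ∇G_{j_k}]`, for the index `j₁` and the list `[j₂, …, j_k]`. -/
def iteratedBracket {D d : ℕ} (M : Set (E D)) (G : E D → E d) (j₁ : Fin d)
    (js : List (Fin d)) : E D → E D :=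
  js.foldl (fun X j => lieBracket M X (gradCoord M G j)) (gradCoord M G j₁)

/-- `Lie^{≥K}(∂G)`: the span of the iterated brackets of `k ≥ K` of the fields `∇G_j`. -/
def lieGE {D d : ℕ} (M : Set (E D)) (G : E D → E d) (K : ℕ) : Submodule ℝ (E D → E D) :=
  Submodule.span ℝ {X | ∃ (j₁ : Fin d) (js : List (Fin d)),
    K ≤ js.length + 1 ∧ X = iteratedBracket M G j₁ js}

/-! ### Legendre functions -/

/-- The domain `{w | R w < ∞}` of `R : ℝ^d → ℝ ∪ {∞}`. -/
def effDom {d : ℕ} (R : E d → WithTop ℝ) : Set (E d) := {w | R w < ⊤}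

/-- The real values of `R` on its domain (the value elsewhere plays no role). -/
def realVal {d : ℕ} (R : E d → WithTop ℝ) (w : E d) : ℝ := (R w).untopD 0

/-- `R : ℝ^d → ℝ ∪ {∞}` is a Legendre function: convex, with a domain of non-empty interior, on
which interior it is differentiable and strictly convex, and the norm of its gradient tends to
infinity along each sequence that converges to a boundary point of the domain. -/
structure IsLegendre {d : ℕ} (R : E d → WithTop ℝ) : Prop where
  convexOn : ConvexOn ℝ (effDom R) (realVal R)
  nonempty : (interior (effDom R)).Nonempty
  differentiableAt : ∀ w ∈ interior (effDom R), DifferentiableAt ℝ (realVal R) w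
  strictConvexOn : StrictConvexOn ℝ (interior (effDom R)) (realVal R)
  tendsto_norm : ∀ (u : ℕ → E d) (w : E d), (∀ n, u n ∈ interior (effDom R)) →
    w ∈ frontier (effDom R) → Tendsto u atTop (𝓝 w) →
    Tendsto (fun n => ‖gradient (realVal R) (u n)‖) atTop atTop

/-! ### Losses, gradient flow and mirror flow -/

/-- A time-dependent loss: there are finitely many times `0 = τ₀ < τ₁ < ⋯ < τₙ` and `C¹` losses
`ℓ₀, …, ℓₙ : ℝ^d → ℝ` with `L_t = ℓᵢ` for `t ∈ [τᵢ, τᵢ₊₁)`, where `τₙ₊₁ = ∞`. -/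
def IsTimeDependentLoss {d : ℕ} (L : ℝ → E d → ℝ) : Prop :=
  ∃ (n : ℕ) (τ : Fin (n + 1) → ℝ) (ℓ : Fin (n + 1) → E d → ℝ),
    τ 0 = 0 ∧ StrictMono τ ∧ (∀ i, ContDiff ℝ 1 (ℓ i)) ∧
    ∀ i t, τ i ≤ t → (∀ j, i < j → t < τ j) → L t = ℓ i

/-- `x : [0, T) → M` solves `dx(t) = -∇(L_t ∘ G)(x(t)) dt`, `x(0) = x₀`. Since the loss is piecewise
constant and right-continuous in time, the equation means that `x` is continuous with the prescribed
right derivative at each time (equivalently, `x` solves the integral equation). -/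
structure IsGradientFlow {D d : ℕ} (M : Set (E D)) (G : E D → E d) (L : ℝ → E d → ℝ)
    (x₀ : E D) (T : ℝ) (x : ℝ → E D) : Prop where
  init : x 0 = x₀
  mem : ∀ t ∈ Ico 0 T, x t ∈ M
  continuousOn : ContinuousOn x (Ico 0 T)
  hasDeriv : ∀ t ∈ Ico 0 T,
    HasDerivWithinAt x (-grad M (fun y => L t (G y)) (x t)) (Ici t) t

/-- `w : [0, T) → int (dom R)` solves `d∇R(w(t)) = -∇L_t(w(t)) dt`, in the same sense. -/
structure IsMirrorFlow {d : ℕ} (R : E d → WithTop ℝ) (L : ℝ → E d → ℝ)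
    (T : ℝ) (w : ℝ → E d) : Prop where
  mem : ∀ t ∈ Ico 0 T, w t ∈ interior (effDom R)
  continuousOn : ContinuousOn (fun t => gradient (realVal R) (w t)) (Ico 0 T)
  hasDeriv : ∀ t ∈ Ico 0 T,
    HasDerivWithinAt (fun s => gradient (realVal R) (w s)) (-gradient (L t) (w t)) (Ici t) t

/-- The gradient flow of `L_t ∘ G` from `x₀` can be written as the mirror flow of `L_t` for `R`:
along each of its solutions `x`, on whatever time interval it exists, `w = G ∘ x` is a mirror flow.
(A solution on `[0, ∞)` is covered through its restrictions to the intervals `[0, T)`.) -/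
def GradientFlowIsMirrorFlow {D d : ℕ} (M : Set (E D)) (G : E D → E d) (L : ℝ → E d → ℝ)
    (x₀ : E D) (R : E d → WithTop ℝ) : Prop :=
  ∀ (T : ℝ) (x : ℝ → E D), 0 < T → IsGradientFlow M G L x₀ T x →
    IsMirrorFlow R L T (fun t => G (x t))

end MirrorFlow

end

/-!
Write `X_j = ∇G_j`, and call *iterated derivatives* the functions `X_{j₁} ⋯ X_{jᵣ} G_j` on `M`.

*Regularity.* If a vector `u ≠ 0` were normal to the range of `∂G(x)`, then the constant curve at `x`
would be a gradient flow for the loss `⟪u, ·⟫`, although the mirror flow moves `∇R` with velocity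
`-u` (`range_jacobian_eq_top`).

*Brackets.* Fix `x₀` and the Legendre function `R` that belongs to it. Following `X_j` forwards or
backwards for a time `t` is a gradient flow for a linear loss, so it adds `t e_j` to the dual variable
`∇R(G)`; flows for successive losses may be concatenated (`Reachable.exists_extension`,
`Reachable.gradient_integralCurve`). Since `∇R` is injective (`IsLegendre.injOn_gradient`), the value
of `G` at a point reached from `x₀` depends only on the total displacement of the dual variable. The
same holds for each iterated derivative, by induction: differentiate the statement for `f` along the
flows of `X_j` from two reachable points with the same value of `G`
(`IsIteratedDeriv.eq_of_reachable`). Hence an iterated derivative `f`, evaluated after following `X_i`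
for time `a` and then `X_j` for time `b`, is a function of `(a, b)` with partial derivatives
`X_i f` and `X_j f`, and an equality of mixed partial derivatives gives `X_i X_j f = X_j X_i f` at
`x₀` (`IsIteratedDeriv.fieldDeriv_comm`). As `x₀` is arbitrary, `[X_i, X_j]` annihilates all iterated
derivatives on all of `M`. If a field `Y` does so, then so does `[Y, X_k]`, because
`[Y, X_k] f = Y (X_k f) - X_k (Y f)` (`fieldDeriv_iteratedBracket`). Applied to the coordinates of `G`
this is the claim.

*Geometry of `M`.* The submanifold enters only through local smooth retractions `π` onto it, obtained
from slice charts. The tangent space at `y` is the range of the idempotent `Dπ(y)`, and a formula for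
the orthogonal projection onto the range of an idempotent shows that gradients of smooth functions are
smooth (`contDiffOn_grad`). Composition with `π` reduces brackets on `M` to brackets in the ambient
space (`fieldDeriv_lieBracket`) and provides integral curves that stay on `M` (`exists_local_flow`).
-/

noncomputable section

namespace MirrorFlow

/-! ### Local smooth retractions onto a submanifold -/

/-- `π` is a smooth retraction of the open set `U` onto `U ∩ M`. -/
structure IsSmoothRetraction {D : ℕ} (M U : Set (E D)) (π : E D → E D) : Prop where
  isOpen : IsOpen U
  contDiffOn : ContDiffOn ℝ ∞ π U
  mem : ∀ y ∈ U, π y ∈ M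
  mapsTo : ∀ y ∈ U, π y ∈ U
  eq_self : ∀ y ∈ U, y ∈ M → π y = y

/-- `M` is locally a smooth retract of the ambient space. This is the only property of
submanifolds that the argument uses. -/
def IsLocalSmoothRetract {D : ℕ} (M : Set (E D)) : Prop :=
  ∀ x ∈ M, ∃ (U : Set (E D)) (π : E D → E D), x ∈ U ∧ IsSmoothRetraction M U π

theorem IsSmoothSubmanifold.isLocalSmoothRetract {D m : ℕ} {M : Set (E D)}
    (hM : IsSmoothSubmanifold m M) : IsLocalSmoothRetract M := by
  intro x hx
  obtain ⟨Φ, hxs, hΦ, hΦ', hiff⟩ := hM.2 x hx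
  let P : E D → E D := fun v => WithLp.toLp 2 fun i => if (i : ℕ) < m then v i else 0
  have hPapp : ∀ v i, P v i = if (i : ℕ) < m then v i else 0 := fun v i => rfl
  have hPc : ContDiff ℝ ∞ P := by
    rw [contDiff_euclidean]
    intro i
    simp only [hPapp]
    split_ifs
    · fun_prop
    · exact contDiff_const
  have hPM : ∀ y ∈ Φ.source, y ∈ M → P (Φ y) = Φ y := by
    intro y hy hyM
    ext i
    rw [hPapp]
    split_ifs with h
    · rfl
    · exact (((hiff y hy).1 hyM) i (not_lt.1 h)).symm
  have hcont : ContinuousOn (fun y => P (Φ y)) Φ.source :=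
    hPc.continuous.comp_continuousOn Φ.continuousOn
  have hPP : ∀ v, P (P v) = P v := by
    intro v; ext i; simp only [hPapp]; split_ifs <;> rfl
  refine ⟨Φ.source ∩ (fun y => P (Φ y)) ⁻¹' Φ.target, fun y => Φ.symm (P (Φ y)),
    ⟨hxs, ?_⟩, ⟨hcont.isOpen_inter_preimage Φ.open_source Φ.open_target, ?_, ?_, ?_, ?_⟩⟩
  · change P (Φ x) ∈ Φ.target
    rw [hPM x hxs hx]; exact Φ.map_source hxs
  · refine hΦ'.comp (hPc.comp_contDiffOn (hΦ.mono inter_subset_left)) fun y hy => hy.2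
  · rintro y ⟨hy, hyt⟩
    refine (hiff _ (Φ.map_target hyt)).2 fun i hi => ?_
    rw [Φ.right_inv hyt, hPapp, if_neg (not_lt.2 hi)]
  · rintro y ⟨hy, hyt⟩
    refine ⟨Φ.map_target hyt, ?_⟩
    change P (Φ (Φ.symm (P (Φ y)))) ∈ Φ.target
    rw [Φ.right_inv hyt, hPP]; exact hyt
  · rintro y ⟨hy, hyt⟩ hyM
    simp only [hPM y hy hyM, Φ.left_inv hy]

namespace IsSmoothRetraction

variable {D : ℕ} {M U : Set (E D)} {π : E D → E D}

theorem contDiffAt (h : IsSmoothRetraction M U π) {y : E D} (hy : y ∈ U) :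
    ContDiffAt ℝ ∞ π y := h.contDiffOn.contDiffAt (h.isOpen.mem_nhds hy)

theorem hasFDerivAt (h : IsSmoothRetraction M U π) {y : E D} (hy : y ∈ U) :
    HasFDerivAt π (fderiv ℝ π y) y :=
  ((h.contDiffAt hy).differentiableAt (by simp)).hasFDerivAt

/-- The differential of `π ∘ π = π`. -/
theorem fderiv_comp_fderiv (h : IsSmoothRetraction M U π) {y : E D} (hy : y ∈ U) :
    (fderiv ℝ π (π y)) ∘L (fderiv ℝ π y) = fderiv ℝ π y := by
  have h1 := (h.hasFDerivAt (h.mapsTo y hy)).comp y (h.hasFDerivAt hy)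
  refine h1.unique ((h.hasFDerivAt hy).congr_of_eventuallyEq ?_)
  filter_upwards [h.isOpen.mem_nhds hy] with z hz
  exact h.eq_self _ (h.mapsTo z hz) (h.mem z hz)

theorem isIdempotentElem_fderiv (h : IsSmoothRetraction M U π) {y : E D} (hy : y ∈ U)
    (hyM : y ∈ M) : IsIdempotentElem (fderiv ℝ π y) := by
  have := h.fderiv_comp_fderiv hy
  rwa [h.eq_self y hy hyM] at this

/-- The tangent space at a point of `M` is the range of the differential of a retraction. -/
theorem mem_tangentSpace_iff (h : IsSmoothRetraction M U π) {y : E D} (hy : y ∈ U)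
    (hyM : y ∈ M) {v : E D} : v ∈ tangentSpace M y ↔ fderiv ℝ π y v = v := by
  constructor
  · intro hv
    induction hv using Submodule.span_induction with
    | mem v hv =>
      obtain ⟨γ, ⟨hs, hM, h0⟩, rfl⟩ := hv
      have hd : HasDerivAt γ (deriv γ 0) 0 :=
        (hs.differentiable (by simp)).differentiableAt.hasDerivAt
      have h1 : HasFDerivAt π (fderiv ℝ π y) (γ 0) := by rw [h0]; exact h.hasFDerivAt hy
      refine (h1.comp_hasDerivAt 0 hd).unique (hd.congr_of_eventuallyEq ?_)
      have : ∀ᶠ t in 𝓝 (0 : ℝ), γ t ∈ U :=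
        hs.continuous.continuousAt.eventually_mem (h.isOpen.mem_nhds (by rwa [h0]))
      filter_upwards [this] with t ht
      exact h.eq_self _ ht (hM t)
    | zero => simp
    | add v w _ _ hv hw => rw [map_add, hv, hw]
    | smul c v _ hv => rw [map_smul, hv]
  · intro hv
    obtain ⟨ε, hε, hball⟩ := Metric.isOpen_iff.1 h.isOpen y hy
    -- A bounded reparametrization keeps the segment `y + s • v` inside `U` for all times.
    obtain ⟨δ, hδ, hδv⟩ : ∃ δ : ℝ, 0 < δ ∧ δ * ‖v‖ < ε := by
      refine ⟨ε / (‖v‖ + 1), by positivity, ?_⟩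
      rw [div_mul_eq_mul_div, div_lt_iff₀ (by positivity)]
      nlinarith [norm_nonneg v]
    let s : ℝ → ℝ := fun t => δ * Real.sin (t / δ)
    have hsc : ContDiff ℝ ∞ s := by
      have : ContDiff ℝ ∞ fun t : ℝ => Real.sin (t / δ) :=
        Real.contDiff_sin.comp (contDiff_id.div_const δ)
      exact contDiff_const.mul this
    have hsd : HasDerivAt s 1 0 := by
      have h1 : HasDerivAt (fun t : ℝ => t / δ) (1 / δ) 0 := (hasDerivAt_id 0).div_const δ
      have h2 := (h1.sin).const_mul δ
      convert! h2 using 1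
      simp; field_simp
    have hsU : ∀ t, y + s t • v ∈ U := by
      intro t
      apply hball
      rw [Metric.mem_ball, dist_eq_norm, add_sub_cancel_left, norm_smul]
      refine lt_of_le_of_lt ?_ hδv
      gcongr
      rw [Real.norm_eq_abs, abs_mul, abs_of_pos hδ]
      exact mul_le_of_le_one_right hδ.le (Real.abs_sin_le_one _)
    have hs0 : s 0 = 0 := by simp [s]
    apply Submodule.subset_span
    refine ⟨fun t => π (y + s t • v), ⟨?_, fun t => h.mem _ (hsU t), ?_⟩, ?_⟩
    · refine contDiff_iff_contDiffAt.2 fun t => ?_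
      exact ContDiffAt.comp t (h.contDiffAt (hsU t))
        (contDiff_const.add (hsc.smul contDiff_const)).contDiffAt
    · simp [hs0, h.eq_self y hy hyM]
    · have h1 : HasDerivAt (fun t => y + s t • v) v 0 := by
        simpa using (hsd.smul_const v).const_add y
      have h2 : HasFDerivAt π (fderiv ℝ π y) (y + s 0 • v) := by
        simpa [hs0] using h.hasFDerivAt hy
      have := (h2.comp_hasDerivAt 0 h1).deriv
      rw [hv] at this
      exact this

/-- The orthogonal projection onto the range of an idempotent `Q` is `Q (Q + Q† - 1)⁻¹`; in this
form it depends smoothly on the base point. -/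
theorem starProjection_tangentSpace (h : IsSmoothRetraction M U π) {y : E D} (hy : y ∈ U)
    (hyM : y ∈ M) :
    IsUnit (fderiv ℝ π y + (fderiv ℝ π y).adjoint - 1) ∧
    (tangentSpace M y).starProjection =
      fderiv ℝ π y * Ring.inverse (fderiv ℝ π y + (fderiv ℝ π y).adjoint - 1) := by
  set Q := fderiv ℝ π y with hQ
  set S := Q + Q.adjoint - 1 with hS
  set P := (tangentSpace M y).starProjection with hP
  have hQQ : ∀ v, Q (Q v) = Q v := fun v =>
    congrArg (fun A : E D →L[ℝ] E D => A v) (h.isIdempotentElem_fderiv hy hyM)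
  have hunit : IsUnit S := by
    have hinj : Function.Injective S := by
      rw [injective_iff_map_eq_zero]
      intro v hv
      have hv' : Q v + Q.adjoint v - v = 0 := by simpa [hS] using hv
      -- applying `Q` and the orthogonality of `Q v` and `v - Q† v`
      have h1 : inner ℝ (Q v) (Q.adjoint v - v) = 0 := by
        rw [inner_sub_right, ContinuousLinearMap.adjoint_inner_right, hQQ, sub_self]
      have h2 : Q.adjoint v - v = - Q v := by
        rw [eq_neg_iff_add_eq_zero, ← hv']; abel
      rw [h2, inner_neg_right, neg_eq_zero, inner_self_eq_zero] at h1
      have h3 : Q.adjoint v = v := by rw [h1, neg_zero, sub_eq_zero] at h2; exact h2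
      have h4 : inner ℝ v v = (0 : ℝ) := by
        nth_rw 1 [← h3]
        rw [ContinuousLinearMap.adjoint_inner_left, h1, inner_zero_right]
      exact inner_self_eq_zero.1 h4
    rw [ContinuousLinearMap.isUnit_iff_bijective]
    exact ⟨hinj, (LinearMap.injective_iff_surjective (f := S.toLinearMap)).1 hinj⟩
  refine ⟨hunit, ?_⟩
  have hPS : P * S = Q := by
    ext1 v
    have hmem : Q v ∈ tangentSpace M y := (h.mem_tangentSpace_iff hy hyM).2 (hQQ v)
    refine Submodule.eq_starProjection_of_mem_of_inner_eq_zero hmem fun w hw => ?_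
    have hw' := (h.mem_tangentSpace_iff hy hyM).1 hw
    have : S v - Q v = Q.adjoint v - v := by simp [hS]; abel
    change inner ℝ (S v - Q v) w = 0
    rw [this, inner_sub_left, ContinuousLinearMap.adjoint_inner_left, hw', sub_self]
  rw [← hPS, mul_assoc, Ring.mul_inverse_cancel _ hunit, mul_one]

/-- Precomposition with a retraction extends a smooth function on `M` to a neighbourhood. -/
theorem contDiffAt_comp (h : IsSmoothRetraction M U π) {F : Type*} [NormedAddCommGroup F]
    [NormedSpace ℝ F] {f : E D → F} (hf : ContDiffOn ℝ ∞ f M) {y : E D} (hy : y ∈ U) :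
    ContDiffAt ℝ ∞ (f ∘ π) y := by
  have : ContDiffOn ℝ ∞ (f ∘ π) U := hf.comp h.contDiffOn h.mem
  exact this.contDiffAt (h.isOpen.mem_nhds hy)

theorem hasFDerivAt_comp (h : IsSmoothRetraction M U π) {F : Type*} [NormedAddCommGroup F]
    [NormedSpace ℝ F] {f : E D → F} (hf : ContDiffOn ℝ ∞ f M) {y : E D} (hy : y ∈ U) :
    HasFDerivAt (f ∘ π) (fderiv ℝ (f ∘ π) y) y :=
  ((h.contDiffAt_comp hf hy).differentiableAt (by simp)).hasFDerivAt

theorem hasFDerivWithinAt (h : IsSmoothRetraction M U π) {F : Type*} [NormedAddCommGroup F]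
    [NormedSpace ℝ F] {f : E D → F} (hf : ContDiffOn ℝ ∞ f M) {y : E D} (hy : y ∈ U)
    (hyM : y ∈ M) : HasFDerivWithinAt f (fderiv ℝ (f ∘ π) y) M y := by
  refine (h.hasFDerivAt_comp hf hy).hasFDerivWithinAt.congr_of_eventuallyEq ?_ ?_
  · filter_upwards [mem_nhdsWithin_of_mem_nhds (h.isOpen.mem_nhds hy), self_mem_nhdsWithin]
      with z hz hzM
    simp [h.eq_self z hz hzM]
  · simp [h.eq_self y hy hyM]

theorem contDiffWithinAt_of_eqOn (h : IsSmoothRetraction M U π) {F : Type*}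
    [NormedAddCommGroup F] [NormedSpace ℝ F] {f g : E D → F} {y : E D} (hy : y ∈ U) (hyM : y ∈ M)
    (hg : ContDiffAt ℝ ∞ g y) (hfg : ∀ z ∈ U, z ∈ M → f z = g z) :
    ContDiffWithinAt ℝ ∞ f M y := by
  refine hg.contDiffWithinAt.congr_of_eventuallyEq ?_ (hfg y hy hyM)
  filter_upwards [mem_nhdsWithin_of_mem_nhds (h.isOpen.mem_nhds hy), self_mem_nhdsWithin]
    with z hz hzM
  exact hfg z hz hzM

end IsSmoothRetraction

/-! ### Gradients and Jacobians on a submanifold -/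

section Gradient

variable {D : ℕ} {M : Set (E D)}

/-- Derivatives relative to `M` are unique on tangent vectors. -/
theorem eq_of_hasFDerivWithinAt {F : Type*} [NormedAddCommGroup F] [NormedSpace ℝ F]
    {f : E D → F} {y : E D} {f₁ f₂ : E D →L[ℝ] F} (h₁ : HasFDerivWithinAt f f₁ M y)
    (h₂ : HasFDerivWithinAt f f₂ M y) {v : E D} (hv : v ∈ tangentSpace M y) : f₁ v = f₂ v := by
  induction hv using Submodule.span_induction with
  | mem v hv =>
    obtain ⟨γ, ⟨hs, hM, rfl⟩, rfl⟩ := hv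
    have hd : HasDerivWithinAt γ (deriv γ 0) univ 0 :=
      (hs.differentiable (by simp)).differentiableAt.hasDerivAt.hasDerivWithinAt
    have h₁' := h₁.comp_hasDerivWithinAt (0 : ℝ) hd (fun t _ => hM t)
    have h₂' := h₂.comp_hasDerivWithinAt (0 : ℝ) hd (fun t _ => hM t)
    rw [hasDerivWithinAt_univ] at h₁' h₂'
    exact h₁'.unique h₂'
  | zero => simp
  | add v w _ _ hv hw => rw [map_add, map_add, hv, hw]
  | smul c v _ hv => rw [map_smul, map_smul, hv]

/-- On tangent vectors, the gradient represents every derivative relative to `M`. -/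
theorem inner_grad_eq {f : E D → ℝ} {y : E D} {f' : E D →L[ℝ] ℝ}
    (hf : HasFDerivWithinAt f f' M y) {v : E D} (hv : v ∈ tangentSpace M y) :
    inner ℝ (grad M f y) v = f' v := by
  rw [grad, Submodule.inner_starProjection_left_eq_right,
    Submodule.starProjection_eq_self_iff.2 hv, inner_gradientWithin_left]
  exact eq_of_hasFDerivWithinAt hf.differentiableWithinAt.hasFDerivWithinAt hf hv

/-- A tangent vector that represents a derivative of `f` relative to `M` is the gradient. -/
theorem grad_eq_of_inner {f : E D → ℝ} {y w : E D} {f' : E D →L[ℝ] ℝ}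
    (hf : HasFDerivWithinAt f f' M y) (hw : w ∈ tangentSpace M y)
    (h : ∀ v ∈ tangentSpace M y, inner ℝ w v = f' v) : grad M f y = w := by
  have hsub : grad M f y - w ∈ tangentSpace M y := Submodule.sub_mem _ (grad_mem M f y) hw
  rw [← sub_eq_zero, ← inner_self_eq_zero (𝕜 := ℝ), inner_sub_left, inner_grad_eq hf hsub,
    h _ hsub, sub_self]

theorem jacobian_apply {n : ℕ} (X : E D → E n) (x v : E D) (i : Fin n) :
    jacobian M X x v i = inner ℝ (grad M (fun y => X y i) x) v := rfl

/-- On tangent vectors, the Jacobian agrees with every derivative relative to `M`. -/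
theorem jacobian_eq {n : ℕ} {X : E D → E n} {y : E D} {X' : E D →L[ℝ] E n}
    (hX : HasFDerivWithinAt X X' M y) {v : E D} (hv : v ∈ tangentSpace M y) :
    jacobian M X y v = X' v := by
  ext i
  rw [jacobian_apply]
  have := (EuclideanSpace.proj (𝕜 := ℝ) i).hasFDerivAt.comp_hasFDerivWithinAt y hX
  exact inner_grad_eq this hv

theorem grad_eq_starProjection {f : E D → ℝ} {y : E D} {f' : E D →L[ℝ] ℝ}
    (hf : HasFDerivWithinAt f f' M y) :
    grad M f y = (tangentSpace M y).starProjection ((InnerProductSpace.toDual ℝ (E D)).symm f') := by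
  refine grad_eq_of_inner hf (Submodule.starProjection_apply_mem _ _) fun v hv => ?_
  rw [Submodule.inner_starProjection_left_eq_right, Submodule.starProjection_eq_self_iff.2 hv,
    InnerProductSpace.toDual_symm_apply]

theorem contDiffOn_grad (hM : IsLocalSmoothRetract M) {f : E D → ℝ} (hf : ContDiffOn ℝ ∞ f M) :
    ContDiffOn ℝ ∞ (grad M f) M := by
  intro y hyM
  obtain ⟨U, π, hy, h⟩ := hM y hyM
  let Q : E D → (E D →L[ℝ] E D) := fderiv ℝ π
  let S : E D → (E D →L[ℝ] E D) := fun z => Q z + (Q z).adjoint - 1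
  have hQ : ContDiffAt ℝ ∞ Q y := (h.contDiffAt hy).fderiv_right (by simp)
  have hstar : ContDiff ℝ ∞ fun A : E D →L[ℝ] E D => A.adjoint :=
    (starL' ℝ : (E D →L[ℝ] E D) ≃L[ℝ] (E D →L[ℝ] E D)).contDiff
  have hadj : ContDiffAt ℝ ∞ (fun z => (Q z).adjoint) y := hstar.contDiffAt.comp y hQ
  have hS : ContDiffAt ℝ ∞ S y := (hQ.add hadj).sub contDiffAt_const
  obtain ⟨u, hu⟩ := (h.starProjection_tangentSpace hy hyM).1
  have hinv : ContDiffAt ℝ ∞ (fun z => Ring.inverse (S z)) y := by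
    have h1 : ContDiffAt ℝ ∞ Ring.inverse (S y) := by
      rw [show S y = u from hu.symm]
      exact contDiffAt_ringInverse ℝ u
    exact h1.comp y hS
  have hdual : IsBoundedLinearMap ℝ (InnerProductSpace.toDual ℝ (E D)).symm :=
    { map_add := map_add _
      map_smul := fun c x => by simp
      bound := ⟨1, one_pos, fun x => by simp⟩ }
  have hg : ContDiffAt ℝ ∞
      (fun z => (InnerProductSpace.toDual ℝ (E D)).symm (fderiv ℝ (f ∘ π) z)) y :=
    hdual.contDiff.contDiffAt.comp y
      ((h.contDiffAt_comp hf hy).fderiv_right (by simp))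
  refine h.contDiffWithinAt_of_eqOn hy hyM ((hQ.clm_comp hinv).clm_apply hg) fun z hz hzM => ?_
  rw [grad_eq_starProjection (h.hasFDerivWithinAt hf hz hzM),
    (h.starProjection_tangentSpace hz hzM).2]
  rfl

end Gradient

/-! ### Brackets of tangent vector fields -/

section Bracket

variable {D : ℕ} {M : Set (E D)}

/-- A smooth vector field on `M`, tangent to `M`. -/
structure IsTangentField (M : Set (E D)) (X : E D → E D) : Prop where
  contDiffOn : ContDiffOn ℝ ∞ X M
  mem : ∀ y ∈ M, X y ∈ tangentSpace M y

/-- The derivative `X f` of a function `f` on `M` along a vector field `X`. -/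
def fieldDeriv (M : Set (E D)) (X : E D → E D) (f : E D → ℝ) (y : E D) : ℝ :=
  inner ℝ (grad M f y) (X y)

theorem isTangentField_grad (hM : IsLocalSmoothRetract M) {f : E D → ℝ}
    (hf : ContDiffOn ℝ ∞ f M) : IsTangentField M (grad M f) :=
  ⟨contDiffOn_grad hM hf, fun y _ => grad_mem M f y⟩

theorem contDiffOn_fieldDeriv (hM : IsLocalSmoothRetract M) {X : E D → E D} {f : E D → ℝ}
    (hX : IsTangentField M X) (hf : ContDiffOn ℝ ∞ f M) :
    ContDiffOn ℝ ∞ (fieldDeriv M X f) M :=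
  (contDiffOn_grad hM hf).inner ℝ hX.contDiffOn

namespace IsSmoothRetraction

variable {U : Set (E D)} {π : E D → E D}

theorem fieldDeriv_eq (h : IsSmoothRetraction M U π) {X : E D → E D} {f : E D → ℝ}
    (hX : IsTangentField M X) (hf : ContDiffOn ℝ ∞ f M) {y : E D} (hy : y ∈ U) (hyM : y ∈ M) :
    fieldDeriv M X f y = fderiv ℝ (f ∘ π) y (X y) :=
  inner_grad_eq (h.hasFDerivWithinAt hf hy hyM) (hX.mem y hyM)

/-- On `M`, the bracket is the bracket in the ambient space of extensions of the fields. -/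
theorem lieBracket_eq (h : IsSmoothRetraction M U π) {X Y : E D → E D}
    (hX : IsTangentField M X) (hY : IsTangentField M Y) {y : E D} (hy : y ∈ U) (hyM : y ∈ M) :
    lieBracket M X Y y = VectorField.lieBracket ℝ (X ∘ π) (Y ∘ π) y := by
  rw [lieBracket, VectorField.lieBracket,
    jacobian_eq (h.hasFDerivWithinAt hY.contDiffOn hy hyM) (hX.mem y hyM),
    jacobian_eq (h.hasFDerivWithinAt hX.contDiffOn hy hyM) (hY.mem y hyM)]
  simp [h.eq_self y hy hyM]

/-- The derivative along a bracket is a commutator of derivatives, where the first-order derivatives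
along the two fields need only be known on `M`. -/
theorem fderiv_lieBracket (h : IsSmoothRetraction M U π) {X Y : E D → E D}
    (hX : IsTangentField M X) (hY : IsTangentField M Y) {y : E D} (hy : y ∈ U) (hyM : y ∈ M)
    {F : Type*} [NormedAddCommGroup F] [NormedSpace ℝ F] {g u v : E D → F}
    {u' v' : E D →L[ℝ] F} (hg : ContDiffAt ℝ ∞ g y)
    (hu : HasFDerivWithinAt u u' M y) (hv : HasFDerivWithinAt v v' M y)
    (hgu : ∀ z ∈ U, z ∈ M → fderiv ℝ g z (X z) = u z)
    (hgv : ∀ z ∈ U, z ∈ M → fderiv ℝ g z (Y z) = v z) :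
    fderiv ℝ g y (lieBracket M X Y y) = v' (X y) - u' (Y y) := by
  have key : ∀ (Z : E D → E D) (w : E D → F) (w' : E D →L[ℝ] F), IsTangentField M Z →
      HasFDerivWithinAt w w' M y → (∀ z ∈ U, z ∈ M → fderiv ℝ g z (Z z) = w z) →
      ∀ t ∈ tangentSpace M y, fderiv ℝ (fun z => fderiv ℝ g z ((Z ∘ π) z)) y t = w' t := by
    intro Z w w' hZ hw hgw t ht
    have hd : DifferentiableAt ℝ (fun z => fderiv ℝ g z ((Z ∘ π) z)) y := by
      have h1 : ContDiffAt ℝ ∞ (fderiv ℝ g) y := hg.fderiv_right (by simp)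
      exact (h1.clm_apply (h.contDiffAt_comp hZ.contDiffOn hy)).differentiableAt (by simp)
    refine eq_of_hasFDerivWithinAt (M := M) (f := w) ?_ hw ht
    refine hd.hasFDerivAt.hasFDerivWithinAt.congr_of_eventuallyEq ?_ ?_
    · filter_upwards [mem_nhdsWithin_of_mem_nhds (h.isOpen.mem_nhds hy), self_mem_nhdsWithin]
        with z hz hzM
      simp only [Function.comp, h.eq_self z hz hzM, hgw z hz hzM]
    · simp only [Function.comp, h.eq_self y hy hyM, hgw y hy hyM]
  have hdiff : ∀ Z, IsTangentField M Z → DifferentiableAt ℝ (Z ∘ π) y := fun Z hZ =>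
    (h.contDiffAt_comp hZ.contDiffOn hy).differentiableAt (by simp)
  rw [h.lieBracket_eq hX hY hy hyM, VectorField.fderiv_apply_lieBracket hg
    (by
      rw [minSmoothness_of_isRCLikeNormedField]
      exact WithTop.coe_le_coe.2 (le_top : (2 : ℕ∞) ≤ ⊤))
    (hdiff Y hY) (hdiff X hX)]
  simp only [Function.comp, h.eq_self y hy hyM]
  rw [← key Y v v' hY hv hgv _ (hX.mem y hyM), ← key X u u' hX hu hgu _ (hY.mem y hyM)]
  rfl

end IsSmoothRetraction

theorem IsTangentField.lieBracket (hM : IsLocalSmoothRetract M) {X Y : E D → E D}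
    (hX : IsTangentField M X) (hY : IsTangentField M Y) :
    IsTangentField M (lieBracket M X Y) := by
  refine ⟨fun y hyM => ?_, fun y hyM => ?_⟩
  · obtain ⟨U, π, hy, h⟩ := hM y hyM
    have hX' := h.contDiffAt_comp hX.contDiffOn hy
    have hY' := h.contDiffAt_comp hY.contDiffOn hy
    refine h.contDiffWithinAt_of_eqOn hy hyM ?_ fun z hz hzM => h.lieBracket_eq hX hY hz hzM
    have h1 : ContDiffAt ℝ ∞ (fderiv ℝ (X ∘ π)) y := hX'.fderiv_right (by simp)
    have h2 : ContDiffAt ℝ ∞ (fderiv ℝ (Y ∘ π)) y := hY'.fderiv_right (by simp)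
    exact (h2.clm_apply hX').sub (h1.clm_apply hY')
  · obtain ⟨U, π, hy, h⟩ := hM y hyM
    rw [h.mem_tangentSpace_iff hy hyM]
    have hT : ∀ Z, IsTangentField M Z → ∀ z ∈ U, z ∈ M → fderiv ℝ π z (Z z) = Z z :=
      fun Z hZ z hz hzM => (h.mem_tangentSpace_iff hz hzM).1 (hZ.mem z hzM)
    rw [h.fderiv_lieBracket hX hY hy hyM (h.contDiffAt hy)
      (h.hasFDerivWithinAt hX.contDiffOn hy hyM) (h.hasFDerivWithinAt hY.contDiffOn hy hyM)
      (hT X hX) (hT Y hY), h.lieBracket_eq hX hY hy hyM]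
    simp [VectorField.lieBracket, h.eq_self y hy hyM]

/-- `[X, Y] f = X (Y f) - Y (X f)`. -/
theorem fieldDeriv_lieBracket (hM : IsLocalSmoothRetract M) {X Y : E D → E D} {f : E D → ℝ}
    (hX : IsTangentField M X) (hY : IsTangentField M Y) (hf : ContDiffOn ℝ ∞ f M)
    {y : E D} (hyM : y ∈ M) :
    fieldDeriv M (lieBracket M X Y) f y =
      fieldDeriv M X (fieldDeriv M Y f) y - fieldDeriv M Y (fieldDeriv M X f) y := by
  obtain ⟨U, π, hy, h⟩ := hM y hyM
  have hXf := contDiffOn_fieldDeriv hM hX hf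
  have hYf := contDiffOn_fieldDeriv hM hY hf
  rw [h.fieldDeriv_eq (hX.lieBracket hM hY) hf hy hyM, h.fieldDeriv_eq hX hYf hy hyM,
    h.fieldDeriv_eq hY hXf hy hyM]
  exact h.fderiv_lieBracket hX hY hy hyM (h.contDiffAt_comp hf hy)
    (h.hasFDerivWithinAt hXf hy hyM) (h.hasFDerivWithinAt hYf hy hyM)
    (fun z hz hzM => (h.fieldDeriv_eq hX hf hz hzM).symm)
    (fun z hz hzM => (h.fieldDeriv_eq hY hf hz hzM).symm)

/-- The chain rule along an integral curve of a tangent field. -/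
theorem hasDerivAt_comp_of_integralCurve (hM : IsLocalSmoothRetract M) {X : E D → E D}
    {f : E D → ℝ} (hX : IsTangentField M X) (hf : ContDiffOn ℝ ∞ f M) {z : ℝ → E D} {t : ℝ}
    (hz : ∀ᶠ s in 𝓝 t, z s ∈ M) (hd : HasDerivAt z (X (z t)) t) :
    HasDerivAt (fun s => f (z s)) (fieldDeriv M X f (z t)) t := by
  obtain ⟨U, π, hy, h⟩ := hM (z t) hz.self_of_nhds
  rw [h.fieldDeriv_eq hX hf hy hz.self_of_nhds]
  refine ((h.hasFDerivAt_comp hf hy).comp_hasDerivAt t hd).congr_of_eventuallyEq ?_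
  filter_upwards [hz, hd.continuousAt.eventually_mem (h.isOpen.mem_nhds hy)] with s hsM hsU
  simp [h.eq_self _ hsU hsM]

end Bracket

/-! ### Integral curves on a submanifold -/

section Flow

variable {D : ℕ} {M : Set (E D)}

/-- `z` is an integral curve of `X` on `M` over `(-ε, ε)` that starts at `y`. -/
structure IsIntegralCurve (M : Set (E D)) (X : E D → E D) (y : E D) (ε : ℝ) (z : ℝ → E D) :
    Prop where
  init : z 0 = y
  mem : ∀ t ∈ Ioo (-ε) ε, z t ∈ M
  hasDerivAt : ∀ t ∈ Ioo (-ε) ε, HasDerivAt z (X (z t)) t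

/-- The local flow of a tangent field on `M`. With `π` a retraction onto `M` near `x`, the curves are
the images under `π` of solutions in the ambient space, for a field whose `π`-image is `X` at the
retracted point; so they stay on `M` automatically. -/
theorem exists_local_flow (hM : IsLocalSmoothRetract M) {X : E D → E D}
    (hX : IsTangentField M X) {x : E D} (hx : x ∈ M) :
    ∃ ε > 0, ∃ r > 0, ∃ α : E D × ℝ → E D,
      (∀ y ∈ M, y ∈ Metric.ball x r → IsIntegralCurve M X y ε fun t => α (y, t)) ∧
      Tendsto α (𝓝 (x, 0)) (𝓝 x) := by
  obtain ⟨U, π, hxU, h⟩ := hM x hx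
  let Q : E D → (E D →L[ℝ] E D) := fderiv ℝ π
  -- On the tangent space at `π z`, the operator `K z` is `Q z`; it is the identity if `z = π z`, so
  -- it is invertible near `x` and gives a right inverse of `Q z` onto this tangent space.
  let K : E D → (E D →L[ℝ] E D) := fun z => Q z * Q (π z) + (1 - Q (π z))
  let V : E D → E D := fun z => Q (π z) (Ring.inverse (K z) (X (π z)))
  have hπx : π x = x := h.eq_self x hxU hx
  have hQ : ContDiffAt ℝ ∞ Q x := (h.contDiffAt hxU).fderiv_right (by simp)
  have hQπ : ContDiffAt ℝ ∞ (fun z => Q (π z)) x := by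
    have : ContDiffAt ℝ ∞ Q (π x) := by rwa [hπx]
    exact this.comp x (h.contDiffAt hxU)
  have hK : ContDiffAt ℝ ∞ K x := (hQ.clm_comp hQπ).add (contDiffAt_const.sub hQπ)
  have hKx : K x = 1 := by
    have : Q x * Q x = Q x := h.isIdempotentElem_fderiv hxU hx
    simp only [K, hπx, this]; abel
  have hinv : ContDiffAt ℝ ∞ (fun z => Ring.inverse (K z)) x := by
    have h1 : ContDiffAt ℝ ∞ Ring.inverse (K x) := by
      rw [hKx]; exact contDiffAt_ringInverse ℝ (1 : (E D →L[ℝ] E D)ˣ)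
    exact h1.comp x hK
  have hV : ContDiffAt ℝ 1 V x :=
    (hQπ.clm_apply (hinv.clm_apply (h.contDiffAt_comp hX.contDiffOn hxU))).of_le (by simp)
  have hKV : ∀ z ∈ U, IsUnit (K z) → Q z (V z) = X (π z) := by
    intro z hz hu
    have hzM := h.mem z hz
    have hzU := h.mapsTo z hz
    have h1 : Q (π z) * Q z = Q z := h.fderiv_comp_fderiv hz
    have h2 : Q (π z) * Q (π z) = Q (π z) := h.isIdempotentElem_fderiv hzU hzM
    have h3 : Q (π z) * K z = Q z * Q (π z) := by
      simp only [K, mul_add, mul_sub, ← mul_assoc, h1, h2, mul_one, sub_self, add_zero]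
    have h4 : Q z * Q (π z) * Ring.inverse (K z) = Q (π z) := by
      rw [← h3, mul_assoc, Ring.mul_inverse_cancel _ hu, mul_one]
    have h5 : Q (π z) (X (π z)) = X (π z) :=
      (h.mem_tangentSpace_iff hzU hzM).1 (hX.mem _ hzM)
    calc Q z (V z) = (Q z * Q (π z) * Ring.inverse (K z)) (X (π z)) := rfl
      _ = X (π z) := by rw [h4, h5]
  -- The neighbourhood on which `V` has the desired image under `π`.
  have hgood : ∀ᶠ z in 𝓝 x, z ∈ U ∧ IsUnit (K z) := by
    have hKu : {A : E D →L[ℝ] E D | IsUnit A} ∈ 𝓝 (K x) := by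
      rw [hKx]; exact Units.isOpen.mem_nhds isUnit_one
    filter_upwards [h.isOpen.mem_nhds hxU, hK.continuousAt.eventually_mem hKu] with z h₁ h₂
    exact ⟨h₁, h₂⟩
  obtain ⟨ε, hε, a, r, L, K', hr, hpl⟩ := IsPicardLindelof.of_contDiffAt_one hV
  obtain ⟨β, hβ, hβc⟩ :=
    (hpl 0).exists_forall_mem_closedBall_eq_hasDerivWithinAt_continuousOn
  have hr' : (0 : ℝ) < r := hr
  have hβx : β (x, 0) = x := (hβ x (Metric.mem_closedBall_self hr'.le)).1
  have hβt : Tendsto β (𝓝 (x, 0)) (𝓝 x) := by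
    have : ContinuousAt β (x, 0) := by
      refine hβc.continuousAt (prod_mem_nhds (Metric.closedBall_mem_nhds x hr') ?_)
      exact Icc_mem_nhds (by linarith) (by linarith)
    simpa [ContinuousAt, hβx] using this
  obtain ⟨ρ, hρ, hρgood⟩ := Metric.eventually_nhds_iff_ball.1 (hβt.eventually hgood)
  refine ⟨min ε ρ, lt_min hε hρ, min r ρ, lt_min hr' hρ, fun p => π (β p), ?_, ?_⟩
  · intro y hyM hy
    have hyr : y ∈ Metric.closedBall x r :=
      Metric.ball_subset_closedBall (Metric.ball_subset_ball (min_le_left _ _) hy)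
    obtain ⟨h0, hd⟩ := hβ y hyr
    have hin : ∀ t ∈ Ioo (-min ε ρ) (min ε ρ), β (y, t) ∈ U ∧ IsUnit (K (β (y, t))) := by
      intro t ht
      refine hρgood (y, t) ?_
      rw [← ball_prod_same]
      refine ⟨Metric.ball_subset_ball (min_le_right _ _) hy, ?_⟩
      rw [Real.ball_eq_Ioo]
      have := min_le_right ε ρ
      exact ⟨by linarith [ht.1], by linarith [ht.2]⟩
    refine ⟨?_, fun t ht => h.mem _ (hin t ht).1, fun t ht => ?_⟩
    · have hyU : y ∈ U := by
        have := (hin 0 ⟨by simp [hε, hρ], by simp [hε, hρ]⟩).1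
        rwa [h0] at this
      change π (β (y, 0)) = y
      rw [h0, h.eq_self y hyU hyM]
    · have hmin := min_le_left ε ρ
      have hd' : HasDerivAt (fun t => β (y, t)) (V (β (y, t))) t :=
        (hd t ⟨by linarith [ht.1], by linarith [ht.2]⟩).hasDerivAt
          (Icc_mem_nhds (by linarith [ht.1]) (by linarith [ht.2]))
      have := (h.hasFDerivAt (hin t ht).1).comp_hasDerivAt t hd'
      rwa [hKV _ (hin t ht).1 (hin t ht).2] at this
  · have := (h.contDiffAt hxU).continuousAt.tendsto.comp hβt
    rwa [hπx] at this

theorem exists_integralCurve (hM : IsLocalSmoothRetract M) {X : E D → E D}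
    (hX : IsTangentField M X) {x : E D} (hx : x ∈ M) :
    ∃ ε > 0, ∃ z, IsIntegralCurve M X x ε z := by
  obtain ⟨ε, hε, r, hr, α, hα, -⟩ := exists_local_flow hM hX hx
  exact ⟨ε, hε, _, hα x hx (Metric.mem_ball_self hr)⟩

end Flow

/-! ### Legendre functions -/

/-- Strict convexity makes the gradient of a Legendre function injective. -/
theorem IsLegendre.injOn_gradient {d : ℕ} {R : E d → WithTop ℝ} (hR : IsLegendre R) :
    InjOn (gradient (realVal R)) (interior (effDom R)) := by
  intro w hw w' hw' heq
  by_contra hne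
  let γ : ℝ → E d := fun t => w + t • (w' - w)
  have hγ : ∀ t ∈ Icc (0 : ℝ) 1, γ t ∈ interior (effDom R) := fun t ht =>
    hR.strictConvexOn.1.add_smul_sub_mem hw hw' ht
  have hd : ∀ t ∈ Icc (0 : ℝ) 1, HasDerivAt (fun t => realVal R (γ t))
      (inner ℝ (gradient (realVal R) (γ t)) (w' - w)) t := by
    intro t ht
    have h1 : HasDerivAt γ (w' - w) t := by
      have h0 := ((hasDerivAt_id t).smul_const (w' - w)).const_add w
      rwa [one_smul] at h0
    have h2 := (hR.differentiableAt _ (hγ t ht)).hasFDerivAt.comp_hasDerivAt t h1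
    rwa [← inner_gradient_left] at h2
  have hconv : StrictConvexOn ℝ (Icc (0 : ℝ) 1) fun t => realVal R (γ t) := by
    refine ⟨convex_Icc 0 1, fun s hs t ht hst a b ha hb hab => ?_⟩
    have hne' : γ s ≠ γ t := by
      intro h
      have h1 : (s - t) • (w' - w) = 0 := by
        rw [sub_smul, sub_eq_zero]; exact add_left_cancel h
      rcases smul_eq_zero.1 h1 with h2 | h2
      · exact hst (sub_eq_zero.1 h2)
      · exact hne (sub_eq_zero.1 h2).symm
    have hcomb : γ (a • s + b • t) = a • γ s + b • γ t := by
      have hb' : b = 1 - a := by linarith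
      subst hb'
      simp only [γ, smul_eq_mul]
      module
    simp only [hcomb]
    exact hR.strictConvexOn.2 (hγ s hs) (hγ t ht) hne' ha hb hab
  have h0 : (0 : ℝ) ∈ Icc (0 : ℝ) 1 := by simp
  have h1 : (1 : ℝ) ∈ Icc (0 : ℝ) 1 := by simp
  have hlt := hconv.strictMonoOn_deriv (fun t ht => (hd t ht).differentiableAt) h0 h1 one_pos
  rw [(hd 0 h0).deriv, (hd 1 h1).deriv] at hlt
  simp [γ, heq] at hlt

/-! ### Concatenation of gradient flows -/

section Reachable

variable {D d : ℕ} {M : Set (E D)} {G : E D → E d} {x₀ y : E D}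

theorem grad_const (c : ℝ) (x : E D) : grad M (fun _ => c) x = 0 :=
  grad_eq_of_inner (hasFDerivWithinAt_const c x M) (Submodule.zero_mem _) (by simp)

/-- `y` is reached from `x₀`, at a time `t` after the last switching time, by the gradient flow of
some time-dependent loss that exists beyond the time `t`. The strict inequalities allow another
piece of the loss to be appended from the time `t` on. -/
def Reachable (M : Set (E D)) (G : E D → E d) (x₀ y : E D) : Prop :=
  ∃ (n : ℕ) (τ : Fin (n + 1) → ℝ) (ℓ : Fin (n + 1) → E d → ℝ) (L : ℝ → E d → ℝ) (T t : ℝ)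
    (x : ℝ → E D), τ 0 = 0 ∧ StrictMono τ ∧ (∀ i, ContDiff ℝ 1 (ℓ i)) ∧
    (∀ i s, τ i ≤ s → (∀ j, i < j → s < τ j) → L s = ℓ i) ∧
    τ (Fin.last n) < t ∧ t < T ∧ IsGradientFlow M G L x₀ T x ∧ x t = y

theorem reachable_self (hx : x₀ ∈ M) : Reachable M G x₀ x₀ := by
  refine ⟨0, fun _ => 0, fun _ _ => 0, fun _ _ => 0, 2, 1, fun _ => x₀, rfl,
    Fin.strictMono_iff_lt_succ.2 fun i => i.elim0,
    fun _ => contDiff_const, fun _ _ _ _ => rfl, one_pos, one_lt_two,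
    ⟨rfl, fun _ _ => hx, continuousOn_const, fun t _ => ?_⟩, rfl⟩
  rw [grad_const, neg_zero]
  exact hasDerivWithinAt_const _ _ _

/-- A gradient flow from a reachable point is the last piece of a gradient flow from `x₀`. -/
theorem Reachable.exists_extension (hy : Reachable M G x₀ y) {l : E d → ℝ} (hl : ContDiff ℝ 1 l)
    {z : ℝ → E D} {ε : ℝ} (hε : 0 < ε) (hz0 : z 0 = y) (hzM : ∀ s ∈ Ico 0 ε, z s ∈ M)
    (hzc : ContinuousOn z (Ico 0 ε))
    (hzd : ∀ s ∈ Ico 0 ε, HasDerivWithinAt z (-grad M (fun q => l (G q)) (z s)) (Ici s) s) :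
    (∀ s ∈ Ico 0 ε, Reachable M G x₀ (z s)) ∧
    ∃ (L : ℝ → E d → ℝ) (t : ℝ) (x : ℝ → E D), IsTimeDependentLoss L ∧ 0 ≤ t ∧
      IsGradientFlow M G L x₀ (t + ε) x ∧
      ∀ s, 0 ≤ s → x (t + s) = z s ∧ L (t + s) = l := by
  obtain ⟨n, τ, ℓ, L, T, t, x, hτ0, hτ, hℓ, hL, hτt, htT, hx, hxt⟩ := id hy
  have ht0 : 0 < t := lt_of_le_of_lt (hτ0 ▸ hτ.monotone (Fin.zero_le _)) hτt
  let τ' : Fin (n + 1 + 1) → ℝ := Fin.snoc τ t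
  let ℓ' : Fin (n + 1 + 1) → E d → ℝ := Fin.snoc ℓ l
  let L' : ℝ → E d → ℝ := fun s => if s < t then L s else l
  -- This is `x s` for `s ≤ t` and `z (s - t)` for `s ≥ t`, in a form that is visibly continuous.
  let x' : ℝ → E D := fun s => x (min s t) + z (max (s - t) 0) - y
  have hτ'c : ∀ i : Fin (n + 1), τ' i.castSucc = τ i := fun i => Fin.snoc_castSucc ..
  have hτ'l : τ' (Fin.last _) = t := Fin.snoc_last ..
  have hℓ'c : ∀ i : Fin (n + 1), ℓ' i.castSucc = ℓ i := fun i => Fin.snoc_castSucc ..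
  have hℓ'l : ℓ' (Fin.last _) = l := Fin.snoc_last ..
  have hx'lt : ∀ s ≤ t, x' s = x s := by
    intro s hs
    simp only [x', min_eq_left hs, max_eq_right (sub_nonpos.2 hs), hz0, add_sub_cancel_right]
  have hx'ge : ∀ s, t ≤ s → x' s = z (s - t) := by
    intro s hs
    simp only [x', min_eq_right hs, max_eq_left (sub_nonneg.2 hs), hxt, add_sub_cancel_left]
  have hτ'0 : τ' 0 = 0 := by
    rw [← hτ0, ← hτ'c 0, Fin.castSucc_zero]
  have hτ'm : StrictMono τ' := by
    refine Fin.strictMono_iff_lt_succ.2 fun i => ?_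
    induction i using Fin.lastCases with
    | last => rw [Fin.succ_last, hτ'l, hτ'c]; exact hτt
    | cast i => rw [hτ'c, Fin.succ_castSucc, hτ'c]; exact hτ (Fin.castSucc_lt_succ)
  have hℓ'd : ∀ i, ContDiff ℝ 1 (ℓ' i) := by
    intro i
    induction i using Fin.lastCases with
    | last => rw [hℓ'l]; exact hl
    | cast i => rw [hℓ'c]; exact hℓ i
  have hL' : ∀ i s, τ' i ≤ s → (∀ j, i < j → s < τ' j) → L' s = ℓ' i := by
    intro i s
    induction i using Fin.lastCases with
    | last =>
      intro hs _
      rw [hτ'l] at hs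
      simp only [L', hℓ'l, if_neg (not_lt.2 hs)]
    | cast i =>
      intro hs hj
      have hst : s < t := hτ'l ▸ hj (Fin.last _) (Fin.castSucc_lt_last i)
      simp only [L', hℓ'c, if_pos hst]
      refine hL i s (hτ'c i ▸ hs) fun j hij => ?_
      rw [← hτ'c]
      exact hj _ (Fin.castSucc_lt_castSucc_iff.2 hij)
  have hflow : IsGradientFlow M G L' x₀ (t + ε) x' := by
    refine ⟨by rw [hx'lt 0 ht0.le, hx.init], fun s hs => ?_, ?_, fun s hs => ?_⟩
    · rcases le_total s t with hst | hst
      · rw [hx'lt s hst]; exact hx.mem s ⟨hs.1, hst.trans_lt htT⟩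
      · rw [hx'ge s hst]; exact hzM _ ⟨sub_nonneg.2 hst, by linarith [hs.2]⟩
    · refine ContinuousOn.sub (ContinuousOn.add ?_ ?_) continuousOn_const
      · refine hx.continuousOn.comp (by fun_prop) fun s hs => ?_
        exact ⟨le_min hs.1 ht0.le, (min_le_right _ _).trans_lt htT⟩
      · refine hzc.comp (by fun_prop) fun s hs => ?_
        exact ⟨le_max_right _ _, max_lt (by linarith [hs.2]) hε⟩
    · rcases lt_or_ge s t with hst | hst
      · have hLs : L' s = L s := if_pos hst
        rw [hLs, hx'lt s hst.le]
        refine (hx.hasDeriv s ⟨hs.1, hst.trans htT⟩).congr_of_eventuallyEq ?_ (hx'lt s hst.le)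
        filter_upwards [mem_nhdsWithin_of_mem_nhds (Iio_mem_nhds hst)] with r hr
        exact hx'lt r (le_of_lt hr)
      · have hLs : L' s = l := if_neg (not_lt.2 hst)
        rw [hLs, hx'ge s hst]
        have h1 := hzd (s - t) ⟨sub_nonneg.2 hst, by linarith [hs.2]⟩
        have h2 := h1.scomp (h := fun r => r - t) s ((hasDerivWithinAt_id s (Ici s)).sub_const t)
          (fun r (hr : s ≤ r) => sub_le_sub_right hr t)
        rw [one_smul] at h2
        exact h2.congr (fun r (hr : s ≤ r) => hx'ge r (hst.trans hr)) (hx'ge s hst)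
  refine ⟨fun s hs => ?_, L', t, x', ⟨n + 1, τ', ℓ', hτ'0, hτ'm, hℓ'd, hL'⟩, ht0.le, hflow,
    fun s hs => ⟨?_, ?_⟩⟩
  · rcases hs.1.eq_or_lt with rfl | hs0
    · rwa [hz0]
    · refine ⟨n + 1, τ', ℓ', L', t + ε, t + s, x', hτ'0, hτ'm, hℓ'd, hL', ?_, ?_, hflow, ?_⟩
      · rw [hτ'l]; linarith
      · linarith [hs.2]
      · rw [hx'ge _ (by linarith), add_sub_cancel_left]
  · rw [hx'ge _ (by linarith), add_sub_cancel_left]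
  · exact if_neg (by linarith)

theorem grad_mul_coord (hM : IsLocalSmoothRetract M) (hG : ContDiffOn ℝ ∞ G M) (c : ℝ)
    (j : Fin d) {q : E D} (hq : q ∈ M) :
    grad M (fun p => c * G p j) q = c • gradCoord M G j q := by
  obtain ⟨U, π, hqU, h⟩ := hM q hq
  have h1 := (EuclideanSpace.proj (𝕜 := ℝ) j).hasFDerivAt.comp_hasFDerivWithinAt q
    (h.hasFDerivWithinAt hG hqU hq)
  refine grad_eq_of_inner (h1.const_mul c) (Submodule.smul_mem _ _ (grad_mem M _ q))
    fun v hv => ?_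
  rw [real_inner_smul_left]
  exact congrArg (c * ·) (inner_grad_eq h1 hv)

variable {R : E d → WithTop ℝ}

/-- The dual variable `∇R(G)` moves with constant speed along a curve of velocity `c ∇G_j` that
starts at a reachable point: this curve is a gradient flow for the loss `w ↦ -c w_j`. -/
theorem Reachable.gradient_forward (hM : IsLocalSmoothRetract M) (hG : ContDiffOn ℝ ∞ G M)
    (hflow : ∀ L, IsTimeDependentLoss L → GradientFlowIsMirrorFlow M G L x₀ R)
    (hy : Reachable M G x₀ y) (c : ℝ) (j : Fin d) {z : ℝ → E D} {ε : ℝ} (hz0 : z 0 = y)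
    (hzM : ∀ s ∈ Ico 0 ε, z s ∈ M)
    (hzd : ∀ s ∈ Ico 0 ε, HasDerivAt z (c • gradCoord M G j (z s)) s) {s : ℝ}
    (hs : s ∈ Ico 0 ε) :
    Reachable M G x₀ (z s) ∧ G (z s) ∈ interior (effDom R) ∧
      gradient (realVal R) (G (z s)) =
        gradient (realVal R) (G y) + (s * c) • EuclideanSpace.single j (1 : ℝ) := by
  have hε : 0 < ε := hs.1.trans_lt hs.2
  set e : E d := EuclideanSpace.single j (1 : ℝ) with he
  let l : E d → ℝ := fun w => -c * w j
  have hl : ContDiff ℝ 1 l := by fun_prop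
  have hlg : ∀ w, gradient l w = -(c • e) := by
    intro w
    refine HasGradientAt.gradient ?_
    rw [hasGradientAt_iff_hasFDerivAt]
    have h1 := ((EuclideanSpace.proj (𝕜 := ℝ) j).hasFDerivAt (x := w)).const_mul (-c)
    refine h1.congr_fderiv ?_
    ext v
    simp [he, EuclideanSpace.inner_single_left]
  obtain ⟨hreach, L, t, x, hL, ht, hx, hxz⟩ := hy.exists_extension hl hε hz0 hzM
    (fun r hr => (hzd r hr).continuousAt.continuousWithinAt) (fun r hr => by
      have h1 : grad M (fun q => l (G q)) (z r) = (-c) • gradCoord M G j (z r) :=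
        grad_mul_coord hM hG (-c) j (hzM r hr)
      rw [h1, neg_smul, neg_neg]
      exact (hzd r hr).hasDerivWithinAt)
  have hmir := hflow L hL (t + ε) x (by linarith) hx
  have hpt : ∀ r ∈ Ico t (t + ε), x r = z (r - t) ∧ L r = l := by
    intro r hr
    have := hxz (r - t) (sub_nonneg.2 hr.1)
    rwa [add_sub_cancel] at this
  have hmem := hmir.mem (t + s) ⟨by linarith [hs.1], by linarith [hs.2]⟩
  simp only [(hxz s hs.1).1] at hmem
  refine ⟨hreach s hs, hmem, ?_⟩
  have hsub : Icc t (t + s) ⊆ Ico 0 (t + ε) := fun r hr =>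
    ⟨ht.trans hr.1, by linarith [hr.2, hs.2]⟩
  have hlin : ∀ r, HasDerivAt
      (fun r => gradient (realVal R) (G y) + ((r - t) * c) • e) (c • e) r := by
    intro r
    have h1 : HasDerivAt (fun r => (r - t) * c) c r := by
      simpa using ((hasDerivAt_id r).sub_const t).mul_const c
    exact (h1.smul_const e).const_add _
  have hconst := eq_of_has_deriv_right_eq (f' := fun _ => c • e)
    (f := fun r => gradient (realVal R) (G (x r)))
    (g := fun r => gradient (realVal R) (G y) + ((r - t) * c) • e) (a := t) (b := t + s)
    (fun r hr => by
      have h1 := hmir.hasDeriv r (hsub (Ico_subset_Icc_self hr))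
      rwa [(hpt r ⟨hr.1, by linarith [hr.2, hs.2]⟩).2, hlg, neg_neg] at h1)
    (fun r _ => (hlin r).hasDerivWithinAt) (hmir.continuousOn.mono hsub)
    (fun r _ => (hlin r).continuousAt.continuousWithinAt)
    (by
      have := (hxz 0 le_rfl).1
      rw [add_zero] at this
      simp [this, hz0]) (t + s) ⟨by linarith [hs.1], le_rfl⟩
  simpa only [(hxz s hs.1).1, add_sub_cancel_left] using hconst

/-- Along an integral curve of `∇G_j` through a reachable point, followed in either direction, all
points are reachable and the dual variable is affine in time. -/
theorem Reachable.gradient_integralCurve (hM : IsLocalSmoothRetract M)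
    (hG : ContDiffOn ℝ ∞ G M)
    (hflow : ∀ L, IsTimeDependentLoss L → GradientFlowIsMirrorFlow M G L x₀ R)
    (hy : Reachable M G x₀ y) {j : Fin d} {z : ℝ → E D} {ε : ℝ}
    (hz : IsIntegralCurve M (gradCoord M G j) y ε z) {t : ℝ} (ht : t ∈ Ioo (-ε) ε) :
    Reachable M G x₀ (z t) ∧ G (z t) ∈ interior (effDom R) ∧
      gradient (realVal R) (G (z t)) =
        gradient (realVal R) (G y) + t • EuclideanSpace.single j (1 : ℝ) := by
  rcases le_total 0 t with h0 | h0
  · have := hy.gradient_forward hM hG hflow 1 j (ε := ε) hz.init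
      (fun s hs => hz.mem s ⟨by linarith [hs.1, hs.2], hs.2⟩)
      (fun s hs => by
        rw [one_smul]
        exact hz.hasDerivAt s ⟨by linarith [hs.1, hs.2], hs.2⟩) ⟨h0, ht.2⟩
    rwa [mul_one] at this
  · have := hy.gradient_forward hM hG hflow (-1) j (ε := ε) (z := fun s => z (-s))
      (by rw [neg_zero]; exact hz.init)
      (fun s hs => hz.mem _ ⟨by linarith [hs.1, hs.2], by linarith [hs.1, hs.2]⟩)
      (fun s hs => by
        have h1 := hz.hasDerivAt (-s) ⟨by linarith [hs.1, hs.2], by linarith [hs.1, hs.2]⟩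
        exact h1.scomp s (hasDerivAt_neg s)) (s := -t) ⟨by linarith, by linarith [ht.1]⟩
    simpa using this

end Reachable

/-! ### Equality of mixed partial derivatives -/

/-- A second difference over a square is a value of the mixed partial derivative. -/
theorem exists_second_difference_eq {F F₁ F₁₂ : ℝ → ℝ → ℝ} {s : ℝ} (hs : 0 < s)
    (h₁ : ∀ a ∈ Icc 0 s, ∀ b ∈ Icc 0 s, HasDerivAt (fun a => F a b) (F₁ a b) a)
    (h₁₂ : ∀ a ∈ Icc 0 s, ∀ b ∈ Icc 0 s, HasDerivAt (fun b => F₁ a b) (F₁₂ a b) b) :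
    ∃ a ∈ Ioo 0 s, ∃ b ∈ Ioo 0 s, F s s - F s 0 - F 0 s + F 0 0 = s * s * F₁₂ a b := by
  have h0 : (0 : ℝ) ∈ Icc 0 s := ⟨le_rfl, hs.le⟩
  have hss : s ∈ Icc 0 s := ⟨hs.le, le_rfl⟩
  have hd : ∀ a ∈ Icc 0 s, HasDerivAt (fun a => F a s - F a 0) (F₁ a s - F₁ a 0) a :=
    fun a ha => (h₁ a ha s hss).sub (h₁ a ha 0 h0)
  obtain ⟨a, ha, hae⟩ := exists_hasDerivAt_eq_slope _ _ hs
    (fun a ha => (hd a ha).continuousAt.continuousWithinAt)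
    (fun a ha => hd a (Ioo_subset_Icc_self ha))
  have ha' := Ioo_subset_Icc_self ha
  obtain ⟨b, hb, hbe⟩ := exists_hasDerivAt_eq_slope _ _ hs
    (fun b hb => (h₁₂ a ha' b hb).continuousAt.continuousWithinAt)
    (fun b hb => h₁₂ a ha' b (Ioo_subset_Icc_self hb))
  refine ⟨a, ha, b, hb, ?_⟩
  rw [sub_zero, eq_div_iff hs.ne'] at hae hbe
  linear_combination -hae - s * hbe

/-- Mixed partial derivatives in the two orders have the same limit at the origin. Unlike for the
usual criteria, no joint differentiability of `F` is assumed. -/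
theorem mixed_partials_eq {F F₁ F₂ F₁₂ F₂₁ : ℝ → ℝ → ℝ} {δ l l' : ℝ} (hδ : 0 < δ)
    (h₁ : ∀ a ∈ Ioo (-δ) δ, ∀ b ∈ Ioo (-δ) δ, HasDerivAt (fun a => F a b) (F₁ a b) a)
    (h₁₂ : ∀ a ∈ Ioo (-δ) δ, ∀ b ∈ Ioo (-δ) δ, HasDerivAt (fun b => F₁ a b) (F₁₂ a b) b)
    (h₂ : ∀ a ∈ Ioo (-δ) δ, ∀ b ∈ Ioo (-δ) δ, HasDerivAt (fun b => F a b) (F₂ a b) b)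
    (h₂₁ : ∀ a ∈ Ioo (-δ) δ, ∀ b ∈ Ioo (-δ) δ, HasDerivAt (fun a => F₂ a b) (F₂₁ a b) a)
    (hl : Tendsto (fun p : ℝ × ℝ => F₁₂ p.1 p.2) (𝓝 (0, 0)) (𝓝 l))
    (hl' : Tendsto (fun p : ℝ × ℝ => F₂₁ p.1 p.2) (𝓝 (0, 0)) (𝓝 l')) : l = l' := by
  by_contra hne
  obtain ⟨V, V', hV, hV', hlV, hlV', hdisj⟩ := t2_separation hne
  have hev := (hl.eventually_mem (hV.mem_nhds hlV)).and (hl'.eventually_mem (hV'.mem_nhds hlV'))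
  obtain ⟨ρ, hρ, hball⟩ := Metric.eventually_nhds_iff_ball.1 hev
  have hmem : ∀ a ∈ Ioo 0 (min δ ρ / 2), ∀ b ∈ Ioo 0 (min δ ρ / 2),
      ((a, b) : ℝ × ℝ) ∈ Metric.ball ((0, 0) : ℝ × ℝ) ρ := by
    intro a ha b hb
    have := min_le_right δ ρ
    rw [← ball_prod_same, Real.ball_eq_Ioo]
    exact ⟨⟨by linarith [ha.1], by linarith [ha.2]⟩, ⟨by linarith [hb.1], by linarith [hb.2]⟩⟩
  have hs : 0 < min δ ρ / 2 := half_pos (lt_min hδ hρ)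
  have hsub : Icc 0 (min δ ρ / 2) ⊆ Ioo (-δ) δ := by
    intro a ha
    have := min_le_left δ ρ
    exact ⟨by linarith [ha.1], by linarith [ha.2]⟩
  obtain ⟨a, ha, b, hb, hab⟩ := exists_second_difference_eq hs
    (fun a ha b hb => h₁ a (hsub ha) b (hsub hb)) (fun a ha b hb => h₁₂ a (hsub ha) b (hsub hb))
  obtain ⟨b', hb', a', ha', hab'⟩ := exists_second_difference_eq (F := fun b a => F a b)
    (F₁ := fun b a => F₂ a b) (F₁₂ := fun b a => F₂₁ a b) hs
    (fun b hb a ha => h₂ a (hsub ha) b (hsub hb)) (fun b hb a ha => h₂₁ a (hsub ha) b (hsub hb))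
  have heq : F₁₂ a b = F₂₁ a' b' := by
    refine mul_left_cancel₀ (mul_pos hs hs).ne' ?_
    linear_combination hab' - hab
  have h1 : F₁₂ a b ∈ V := (hball _ (hmem a ha b hb)).1
  have h2 : F₂₁ a' b' ∈ V' := (hball _ (hmem a' ha' b' hb')).2
  exact Set.disjoint_left.1 hdisj h1 (heq ▸ h2)

/-! ### Functions of the dual variable -/

section Commutation

variable {D d : ℕ} {M : Set (E D)} {G : E D → E d} {R : E d → WithTop ℝ} {x₀ : E D}

/-- The functions `∇G_{j₁} ⋯ ∇G_{jᵣ} G_j` obtained from the coordinates of `G` by repeated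
differentiation along the fields `∇G_j`. -/
inductive IsIteratedDeriv (M : Set (E D)) (G : E D → E d) : (E D → ℝ) → Prop
  | coord (j : Fin d) : IsIteratedDeriv M G fun y => G y j
  | fieldDeriv (j : Fin d) {f : E D → ℝ} (hf : IsIteratedDeriv M G f) :
      IsIteratedDeriv M G (fieldDeriv M (gradCoord M G j) f)

theorem contDiffOn_coord (hG : ContDiffOn ℝ ∞ G M) (j : Fin d) :
    ContDiffOn ℝ ∞ (fun y => G y j) M :=
  contDiffOn_euclidean.1 hG j

theorem isTangentField_gradCoord (hM : IsLocalSmoothRetract M) (hG : ContDiffOn ℝ ∞ G M)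
    (j : Fin d) : IsTangentField M (gradCoord M G j) :=
  isTangentField_grad hM (contDiffOn_coord hG j)

theorem IsIteratedDeriv.contDiffOn (hM : IsLocalSmoothRetract M) (hG : ContDiffOn ℝ ∞ G M)
    {f : E D → ℝ} (hf : IsIteratedDeriv M G f) : ContDiffOn ℝ ∞ f M := by
  induction hf with
  | coord j => exact contDiffOn_coord hG j
  | fieldDeriv j _ ih => exact contDiffOn_fieldDeriv hM (isTangentField_gradCoord hM hG j) ih

theorem IsIntegralCurve.hasDerivAt_comp (hM : IsLocalSmoothRetract M) {X : E D → E D}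
    (hX : IsTangentField M X) {f : E D → ℝ} (hf : ContDiffOn ℝ ∞ f M) {y : E D} {z : ℝ → E D}
    {ε t : ℝ} (hz : IsIntegralCurve M X y ε z) (ht : t ∈ Ioo (-ε) ε) :
    HasDerivAt (fun s => f (z s)) (fieldDeriv M X f (z t)) t := by
  refine hasDerivAt_comp_of_integralCurve hM hX hf ?_ (hz.hasDerivAt t ht)
  filter_upwards [Ioo_mem_nhds ht.1 ht.2] with s hs using hz.mem s hs

theorem Reachable.mem {y : E D} (hy : Reachable M G x₀ y) : y ∈ M := by
  obtain ⟨n, τ, ℓ, L, T, t, x, hτ0, hτ, -, -, hτt, htT, hx, rfl⟩ := hy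
  have hτn : τ 0 ≤ τ (Fin.last n) := hτ.monotone (Fin.zero_le _)
  exact hx.mem t ⟨by linarith, htT⟩

/-- At reachable points an iterated derivative is a function of `G`: from two points with the same
value of `G`, the flows of `∇G_j` move the dual variable equally, so that `G` stays equal along
them, and equalities between functions of `G` may be differentiated. -/
theorem IsIteratedDeriv.eq_of_reachable (hM : IsLocalSmoothRetract M)
    (hG : ContDiffOn ℝ ∞ G M) (hR : IsLegendre R)
    (hflow : ∀ L, IsTimeDependentLoss L → GradientFlowIsMirrorFlow M G L x₀ R)
    {f : E D → ℝ} (hf : IsIteratedDeriv M G f) :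
    ∀ {y y' : E D}, Reachable M G x₀ y → Reachable M G x₀ y' → G y = G y' → f y = f y' := by
  induction hf with
  | coord j => exact fun _ _ h => congrArg (fun w : E d => w j) h
  | @fieldDeriv j f hf ih =>
    intro y y' hy hy' hyy'
    have hX := isTangentField_gradCoord hM hG j
    have hfs := hf.contDiffOn hM hG
    obtain ⟨ε, hε, z, hz⟩ := exists_integralCurve hM hX hy.mem
    obtain ⟨ε', hε', z', hz'⟩ := exists_integralCurve hM hX hy'.mem
    have hd := hz.hasDerivAt_comp hM hX hfs (t := 0) ⟨by linarith, hε⟩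
    have hd' := hz'.hasDerivAt_comp hM hX hfs (t := 0) ⟨by linarith, hε'⟩
    rw [hz.init] at hd
    rw [hz'.init] at hd'
    refine hd.unique (hd'.congr_of_eventuallyEq ?_)
    filter_upwards [Ioo_mem_nhds (neg_lt_zero.2 hε) hε, Ioo_mem_nhds (neg_lt_zero.2 hε') hε']
      with t ht ht'
    obtain ⟨hr, hi, hg⟩ := hy.gradient_integralCurve hM hG hflow hz ht
    obtain ⟨hr', hi', hg'⟩ := hy'.gradient_integralCurve hM hG hflow hz' ht'
    exact ih hr hr' (hR.injOn_gradient hi hi' (by rw [hg, hg', hyy']))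

/-- Derivatives along `∇G_i` and `∇G_j` commute on iterated derivatives. Along the points reached by
flowing for time `a` along `∇G_i` and then for time `b` along `∇G_j`, iterated derivatives are
functions of the dual variable alone, so that the order of the two flows does not matter. -/
theorem IsIteratedDeriv.fieldDeriv_comm (hM : IsLocalSmoothRetract M)
    (hG : ContDiffOn ℝ ∞ G M) (hR : IsLegendre R) (hx₀ : x₀ ∈ M)
    (hflow : ∀ L, IsTimeDependentLoss L → GradientFlowIsMirrorFlow M G L x₀ R)
    {f : E D → ℝ} (hf : IsIteratedDeriv M G f) (i j : Fin d) :
    MirrorFlow.fieldDeriv M (gradCoord M G i) (MirrorFlow.fieldDeriv M (gradCoord M G j) f) x₀ =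
      MirrorFlow.fieldDeriv M (gradCoord M G j)
        (MirrorFlow.fieldDeriv M (gradCoord M G i) f) x₀ := by
  have hXi := isTangentField_gradCoord hM hG i
  have hXj := isTangentField_gradCoord hM hG j
  obtain ⟨ε₁, hε₁, α, hα⟩ := exists_integralCurve hM hXi hx₀
  obtain ⟨ε₂, hε₂, r, hr, β, hβ, hβt⟩ := exists_local_flow hM hXj hx₀
  have hαt : Tendsto α (𝓝 0) (𝓝 x₀) := by
    have := (hα.hasDerivAt 0 ⟨by linarith, hε₁⟩).continuousAt.tendsto
    rwa [hα.init] at this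
  obtain ⟨ρ, hρ, hball⟩ :=
    Metric.eventually_nhds_iff_ball.1 (hαt.eventually_mem (Metric.ball_mem_nhds x₀ hr))
  obtain ⟨δ, hδ, hδ₁, hδ₂, hδρ⟩ : ∃ δ > 0, δ ≤ ε₁ ∧ δ ≤ ε₂ ∧ δ ≤ ρ :=
    ⟨min ε₁ (min ε₂ ρ), by positivity, min_le_left _ _,
      (min_le_right _ _).trans (min_le_left _ _), (min_le_right _ _).trans (min_le_right _ _)⟩
  have hin : ∀ {ε a : ℝ}, δ ≤ ε → a ∈ Ioo (-δ) δ → a ∈ Ioo (-ε) ε := fun h ha =>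
    ⟨by linarith [ha.1], by linarith [ha.2]⟩
  let p : ℝ → ℝ → E D := fun a b => β (α a, b)
  have hcurve : ∀ a ∈ Ioo (-δ) δ, IsIntegralCurve M (gradCoord M G j) (α a) ε₂ (p a) := by
    intro a ha
    refine hβ _ (hα.mem a (hin hδ₁ ha)) (hball a ?_)
    rw [Real.ball_eq_Ioo, zero_sub, zero_add]
    exact hin hδρ ha
  have hdual : ∀ a ∈ Ioo (-δ) δ, ∀ b ∈ Ioo (-δ) δ, Reachable M G x₀ (p a b) ∧
      G (p a b) ∈ interior (effDom R) ∧ gradient (realVal R) (G (p a b)) =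
        gradient (realVal R) (G x₀) + a • EuclideanSpace.single i (1 : ℝ) +
          b • EuclideanSpace.single j (1 : ℝ) := by
    intro a ha b hb
    obtain ⟨h1, -, h2⟩ :=
      (reachable_self hx₀).gradient_integralCurve hM hG hflow hα (hin hδ₁ ha)
    have := h1.gradient_integralCurve hM hG hflow (hcurve a ha) (hin hδ₂ hb)
    rwa [h2] at this
  have hdb : ∀ {g : E D → ℝ}, ContDiffOn ℝ ∞ g M → ∀ a ∈ Ioo (-δ) δ, ∀ b ∈ Ioo (-δ) δ,
      HasDerivAt (fun b => g (p a b)) (MirrorFlow.fieldDeriv M (gradCoord M G j) g (p a b)) b :=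
    fun hg a ha b hb => (hcurve a ha).hasDerivAt_comp hM hXj hg (hin hδ₂ hb)
  have hda : ∀ {g : E D → ℝ}, IsIteratedDeriv M G g → ∀ a ∈ Ioo (-δ) δ, ∀ b ∈ Ioo (-δ) δ,
      HasDerivAt (fun a => g (p a b)) (MirrorFlow.fieldDeriv M (gradCoord M G i) g (p a b)) a := by
    intro g hg a ha b hb
    obtain ⟨hy, -, hgy⟩ := hdual a ha b hb
    obtain ⟨ε, hε, z, hz⟩ := exists_integralCurve hM hXi hy.mem
    -- The curve `a' ↦ p a' b` need not be an integral curve of `∇G_i`, but `g` cannot tell it from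
    -- the integral curve through `p a b`.
    have hd : HasDerivAt (fun t => g (z (t - a)))
        (MirrorFlow.fieldDeriv M (gradCoord M G i) g (p a b)) a := by
      have h1 := hz.hasDerivAt_comp hM hXi (hg.contDiffOn hM hG) (t := a - a)
        ⟨by linarith, by linarith⟩
      rw [sub_self, hz.init, ← sub_self a] at h1
      exact h1.comp_sub_const a a
    refine hd.congr_of_eventuallyEq ?_
    filter_upwards [Ioo_mem_nhds ha.1 ha.2,
      Ioo_mem_nhds (show a - ε < a by linarith) (show a < a + ε by linarith)] with t ht htε
    obtain ⟨hr, hi, hgr⟩ := hdual t ht b hb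
    obtain ⟨hr', hi', hgr'⟩ := hy.gradient_integralCurve hM hG hflow hz (t := t - a)
      ⟨by linarith [htε.1], by linarith [htε.2]⟩
    refine hg.eq_of_reachable hM hG hR hflow hr hr' (hR.injOn_gradient hi hi' ?_)
    rw [hgr, hgr', hgy]
    module
  have hpt : Tendsto (fun q : ℝ × ℝ => p q.1 q.2) (𝓝 (0, 0)) (𝓝[M] x₀) := by
    refine tendsto_nhdsWithin_iff.2 ⟨?_, ?_⟩
    · refine hβt.comp ?_
      rw [nhds_prod_eq, nhds_prod_eq]
      exact (hαt.comp tendsto_fst).prodMk tendsto_snd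
    · filter_upwards [prod_mem_nhds (Ioo_mem_nhds (neg_lt_zero.2 hδ) hδ)
        (Ioo_mem_nhds (neg_lt_zero.2 hδ) hδ)] with q hq
      exact (hdual q.1 hq.1 q.2 hq.2).1.mem
  have hlim : ∀ {g : E D → ℝ}, IsIteratedDeriv M G g →
      Tendsto (fun q : ℝ × ℝ => g (p q.1 q.2)) (𝓝 (0, 0)) (𝓝 (g x₀)) := fun hg =>
    ((hg.contDiffOn hM hG).continuousOn x₀ hx₀).tendsto.comp hpt
  have hfi := IsIteratedDeriv.fieldDeriv i hf
  have hfj := IsIteratedDeriv.fieldDeriv j hf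
  exact (mixed_partials_eq hδ (hda hf) (hdb (hfi.contDiffOn hM hG)) (hdb (hf.contDiffOn hM hG))
    (hda hfj) (hlim (hfi.fieldDeriv j)) (hlim (hfj.fieldDeriv i))).symm

end Commutation

/-! ### Iterated brackets -/

section Main

variable {D d : ℕ} {M : Set (E D)} {G : E D → E d}

/-- The iterated brackets of length at least two annihilate all iterated derivatives, provided that
derivatives along the fields `∇G_j` commute on them: the set of annihilating fields is stable under
bracketing with `∇G_k`, because the iterated derivatives are stable under differentiation. -/
theorem fieldDeriv_iteratedBracket (hM : IsLocalSmoothRetract M) (hG : ContDiffOn ℝ ∞ G M)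
    (hcomm : ∀ f, IsIteratedDeriv M G f → ∀ i j, ∀ y ∈ M,
      fieldDeriv M (gradCoord M G i) (fieldDeriv M (gradCoord M G j) f) y =
        fieldDeriv M (gradCoord M G j) (fieldDeriv M (gradCoord M G i) f) y)
    (j₁ : Fin d) (js : List (Fin d)) (hjs : 2 ≤ js.length + 1) {f : E D → ℝ}
    (hf : IsIteratedDeriv M G f) {y : E D} (hy : y ∈ M) :
    fieldDeriv M (iteratedBracket M G j₁ js) f y = 0 := by
  have hX := isTangentField_gradCoord hM hG
  have key : ∀ (l : List (Fin d)) (Z : E D → E D), IsTangentField M Z →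
      (∀ f, IsIteratedDeriv M G f → ∀ y ∈ M, fieldDeriv M Z f y = 0) →
      ∀ f, IsIteratedDeriv M G f → ∀ y ∈ M,
        fieldDeriv M (l.foldl (fun X j => lieBracket M X (gradCoord M G j)) Z) f y = 0 := by
    intro l
    induction l with
    | nil => exact fun Z _ h => h
    | cons k l ih =>
      intro Z hZ h
      refine ih _ (hZ.lieBracket hM (hX k)) fun f hf y hy => ?_
      have h0 : HasFDerivWithinAt (fieldDeriv M Z f) (0 : E D →L[ℝ] ℝ) M y :=
        (hasFDerivWithinAt_const (0 : ℝ) y M).congr (fun z hz => h f hf z hz) (h f hf y hy)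
      rw [fieldDeriv_lieBracket hM hZ (hX k) (hf.contDiffOn hM hG) hy, h _ (hf.fieldDeriv k) y hy,
        fieldDeriv, inner_grad_eq h0 ((hX k).mem y hy)]
      simp
  match js, hjs with
  | k :: l, _ =>
    refine key l _ ((hX j₁).lieBracket hM (hX k)) (fun f hf y hy => ?_) f hf y hy
    rw [fieldDeriv_lieBracket hM (hX j₁) (hX k) (hf.contDiffOn hM hG) hy, hcomm f hf j₁ k y hy,
      sub_self]

/-- If the range of the Jacobian at `x` had a non-zero normal vector `u`, then `x` would be
stationary for the loss `⟪u, ·⟫`, while the dual variable would move with velocity `-u`. -/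
theorem range_jacobian_eq_top (hM : IsLocalSmoothRetract M) (hG : ContDiffOn ℝ ∞ G M)
    {R : E d → WithTop ℝ} {x : E D} (hx : x ∈ M)
    (hflow : ∀ L, IsTimeDependentLoss L → GradientFlowIsMirrorFlow M G L x R) :
    LinearMap.range (jacobian M G x) = ⊤ := by
  rw [← Submodule.orthogonal_eq_bot_iff, Submodule.eq_bot_iff]
  intro u hu
  obtain ⟨U, π, hxU, h⟩ := hM x hx
  let l : E d → ℝ := fun w => inner ℝ u w
  have hgrad : grad M (fun y => l (G y)) x = 0 := by
    have h1 := h.hasFDerivWithinAt hG hxU hx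
    refine grad_eq_of_inner ((innerSL ℝ u).hasFDerivAt.comp_hasFDerivWithinAt x h1)
      (Submodule.zero_mem _) fun v hv => ?_
    rw [inner_zero_left, ContinuousLinearMap.comp_apply, ← jacobian_eq h1 hv]
    exact ((Submodule.mem_orthogonal' _ _).1 hu _ ⟨v, rfl⟩).symm
  have hL : IsTimeDependentLoss fun _ => l :=
    ⟨0, fun _ => 0, fun _ => l, rfl, Fin.strictMono_iff_lt_succ.2 fun i => i.elim0,
      fun _ => (innerSL ℝ u).contDiff, fun _ _ _ _ => rfl⟩
  have hx : IsGradientFlow M G (fun _ => l) x 1 fun _ => x :=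
    ⟨rfl, fun _ _ => hx, continuousOn_const, fun t _ => by
      rw [hgrad, neg_zero]; exact hasDerivWithinAt_const _ _ _⟩
  have h1 := (hflow _ hL 1 _ one_pos hx).hasDeriv 0 ⟨le_rfl, one_pos⟩
  have h2 := (uniqueDiffWithinAt_Ici (0 : ℝ)).eq_deriv _ h1 (hasDerivWithinAt_const _ _ _)
  have h3 : gradient l (G x) = u :=
    HasGradientAt.gradient (innerSL ℝ u).hasFDerivAt
  rwa [h3, neg_eq_zero] at h2

end Main

end MirrorFlow

end

theorem mainTheorem3 (D d m : ℕ) (M : Set (MirrorFlow.E D))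
    (hM : MirrorFlow.IsSmoothSubmanifold m M)
    (G : MirrorFlow.E D → MirrorFlow.E d) (hG : ContDiffOn ℝ ∞ G M)
    (h : ∀ x₀ ∈ M, ∃ R : MirrorFlow.E d → WithTop ℝ, MirrorFlow.IsLegendre R ∧
      ∀ L : ℝ → MirrorFlow.E d → ℝ, MirrorFlow.IsTimeDependentLoss L →
        MirrorFlow.GradientFlowIsMirrorFlow M G L x₀ R) :
    MirrorFlow.IsRegularParametrization M G ∧
      ∀ x ∈ M, (fun X : MirrorFlow.E D → MirrorFlow.E D => X x) '' MirrorFlow.lieGE M G 2 ⊆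
        (LinearMap.ker (MirrorFlow.jacobian M G x) : Set (MirrorFlow.E D)) := by
  have hM' := hM.isLocalSmoothRetract
  refine ⟨⟨hG.of_le (by simp), fun x hx => ?_⟩, fun x hx => ?_⟩
  · obtain ⟨R, -, hflow⟩ := h x hx
    rw [MirrorFlow.range_jacobian_eq_top hM' hG hx hflow, finrank_top, finrank_euclideanSpace,
      Fintype.card_fin]
  · rintro _ ⟨X, hX, rfl⟩
    change X x ∈ LinearMap.ker (MirrorFlow.jacobian M G x)
    induction hX using Submodule.span_induction with
    | mem X hX =>
      obtain ⟨j₁, js, hjs, rfl⟩ := hX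
      rw [LinearMap.mem_ker]
      ext j
      refine MirrorFlow.fieldDeriv_iteratedBracket hM' hG (fun f hf i k y hy => ?_) j₁ js hjs
        (.coord j) hx
      obtain ⟨R, hR, hflow⟩ := h y hy
      exact hf.fieldDeriv_comm hM' hG hR hy hflow i k
    | zero => exact Submodule.zero_mem _
    | add X Y _ _ hX hY => exact Submodule.add_mem _ hX hY
    | smul c X _ hX => exact Submodule.smul_mem _ c hX
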